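/- Let $F$ be a field, $n\ge 1$, let $G$ be a connected simple graph on the vertex set $[n]=\{1,\dots,n\}$, and let $S=F[x_1,\dots,x_n,y_1,\dots,y_n]$. The binomial edge ideal of $G$ is $J_G=\langle x_iy_j-x_jy_i : \{i,j\}\in E(G)\rangle\subseteq S$. For $i,j\in[n]$, an $(i,j)$-path in $G$ is a sequence of vertices $i=i_0,i_1,\dots,i_r=j$ ($r\ge 0$) with $\{i_k,i_{k+1}\}\in E(G)$ for all $0\le k<r$. It is called weakly admissible if its vertices are pairwise distinct and there is no $(i,j)$-path $(j_0,\dots,j_s)$ in $G$ with $\{j_0,\dots,j_s\}\subsetneq\{i_0,\dots,i_r\}$. Consider the following three subsets of $S$. * $\mathcal S(J_G)$ is the set of all nonzero binomials $t_{i_1}t_{i_2}\cdots t_{i_{r-1}}(x_iy_j-x_jy_i)$, where $i,j\in[n]$, $(i_0,\dots,i_r)$ is a weakly admissible $(i,j)$-path in $G$ and $t_k\in\{x_k,y_k\}$ for each $k$. * $\mathcal U(J_G)$ is the universal Gröbner basis of $J_G$, that is, the union of the reduced Gröbner bases of $J_G$ with respect to all monomial orders on $S$. * $\mathrm{Gr}(J_G)$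 is the Graver basis of $J_G$, that is, the set of primitive binomials of $J_G$. Here a nonzero binomial $\mathbf x^{u}-\mathbf x^{v}\in J_G$ (a difference of two distinct monic monomials of $S$) is primitive if there is no other nonzero binomial $\mathbf x^{u'}-\mathbf x^{v'}\in J_G$ such that $\mathbf x^{u'}$ divides $\mathbf x^{u}$ and $\mathbf x^{v'}$ divides $\mathbf x^{v}$. Then $\mathcal S(J_G)=\mathcal U(J_G)=\mathrm{Gr}(J_G)$. -/

import Mathlib

open MvPolynomial

noncomputable section

namespace BEI

universe u v

section Groebner

variable {σ : Type u} {F : Type v} [Field F]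

/-- `B` is a Gröbner basis of `I` with respect to `m`: a finite subset of `I` whose leading terms
generate the ideal generated by the leading terms of all elements of `I`. -/
def IsGroebnerBasis (m : MonomialOrder.{u, u} σ) (I : Ideal (MvPolynomial σ F))
    (B : Set (MvPolynomial σ F)) : Prop :=
  B.Finite ∧ B ⊆ (I : Set (MvPolynomial σ F)) ∧
    Ideal.span (m.leadingTerm '' B) = Ideal.span (m.leadingTerm '' (I : Set (MvPolynomial σ F)))

/-- A Gröbner basis is reduced if its elements are monic and no monomial occurring in an element
`b` is divisible by the leading monomial of another element. -/
def IsReducedGroebnerBasis (m : MonomialOrder.{u, u} σ) (I : Ideal (MvPolynomial σ F))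
    (B : Set (MvPolynomial σ F)) : Prop :=
  IsGroebnerBasis m I B ∧ (∀ b ∈ B, m.Monic b) ∧
    ∀ b ∈ B, ∀ d ∈ b.support, ∀ b' ∈ B, b' ≠ b → ¬ m.degree b' ≤ d

/-- The universal Gröbner basis: the union of all reduced Gröbner bases, over all monomial orders.
(Every monomial order can be carried by the type `σ →₀ ℕ` itself, so the universe chosen here
does not restrict the orders.) -/
def universalGroebnerBasis (I : Ideal (MvPolynomial σ F)) : Set (MvPolynomial σ F) :=
  {f | ∃ (m : MonomialOrder.{u, u} σ) (B : Set (MvPolynomial σ F)),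
    IsReducedGroebnerBasis m I B ∧ f ∈ B}

/-- The pure difference binomial with exponent vectors `a` and `b`. -/
def binomial (F : Type v) [Field F] (a b : σ →₀ ℕ) : MvPolynomial σ F :=
  monomial a 1 - monomial b 1

/-- The (nonzero) binomial with exponents `a ≠ b` lies in `I`, and there is no other nonzero
binomial in `I`, with exponents `a'`, `b'`, such that the first monomial divides the first one and
the second the second one. -/
def IsPrimitive (I : Ideal (MvPolynomial σ F)) (a b : σ →₀ ℕ) : Prop :=
  a ≠ b ∧ binomial F a b ∈ I ∧
    ∀ a' b' : σ →₀ ℕ, a' ≠ b' → binomial F a' b' ∈ I → a' ≤ a → b' ≤ b → a' = a ∧ b' = b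

/-- The Graver basis: the set of primitive binomials. -/
def graverBasis (I : Ideal (MvPolynomial σ F)) : Set (MvPolynomial σ F) :=
  {f | ∃ a b : σ →₀ ℕ, IsPrimitive I a b ∧ f = binomial F a b}

end Groebner

section Graph

variable {V : Type u}

/-- The variable `x_i`. -/
def x (F : Type v) [Field F] (i : V) : MvPolynomial (V ⊕ V) F := X (Sum.inl i)

/-- The variable `y_i`. -/
def y (F : Type v) [Field F] (i : V) : MvPolynomial (V ⊕ V) F := X (Sum.inr i)

/-- The binomial edge ideal of `G`. -/
def binomialEdgeIdeal (F : Type v) [Field F] (G : SimpleGraph V) :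
    Ideal (MvPolynomial (V ⊕ V) F) :=
  Ideal.span {f | ∃ i j : V, G.Adj i j ∧ f = x F i * y F j - x F j * y F i}

/-- An `(i, j)`-path (a walk in Mathlib's terms) is weakly admissible if it has no repeated vertex
and no proper subset of its vertex set is the vertex set of an `(i, j)`-path. -/
def WeaklyAdmissible {G : SimpleGraph V} {i j : V} (p : G.Walk i j) : Prop :=
  p.support.Nodup ∧
    ∀ q : G.Walk i j, ¬ ({k | k ∈ q.support} ⊂ {k | k ∈ p.support})

/-- The nonzero binomials `t_{i_1} ⋯ t_{i_{r-1}} (x_i y_j - x_j y_i)`, where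
`i = i_0, i_1, …, i_r = j` is a weakly admissible path and each `t_k` is `x_k` or `y_k`.
The list `p.support.tail.dropLast` is `[i_1, …, i_{r-1}]` (empty for `r = 0, 1`). -/
def pathBinomials (F : Type v) [Field F] (G : SimpleGraph V) : Set (MvPolynomial (V ⊕ V) F) :=
  {f | f ≠ 0 ∧ ∃ (i j : V) (p : G.Walk i j), WeaklyAdmissible p ∧
    ∃ t : V → MvPolynomial (V ⊕ V) F, (∀ k, t k = x F k ∨ t k = y F k) ∧
      f = (p.support.tail.dropLast.map t).prod * (x F i * y F j - x F j * y F i)}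

end Graph

end BEI

end

/-!
If `x^a - x^b ∈ J_G`, then `a` and `b` have the same degree at every vertex and the same degree in
the `x`-variables on every connected component of their support: these data are compatible with
multiplication and agree on the two terms of each generator. So if `a ≠ b`, some vertex `i` where
`a` has more `x`s than `b` is joined inside the support to a vertex `j` where it has fewer. A
shortest walk between two such vertices is weakly admissible, and `a`, `b` agree at its inner
vertices, so the two terms of one of its path binomials divide `x^a` and `x^b`. Hence primitive
binomials are path binomials; the converse holds because a path binomial below that of a weakly
admissible path has the same endpoints and a smaller vertex set.

The elements of a reduced Gröbner basis of an ideal generated by pure difference binomials are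
primitive. For a given path binomial, a suitable lexicographic order makes its leading monomial
divisible by no other leading monomial of a path binomial, so it lies in the reduced Gröbner basis.
-/

open MvPolynomial

namespace BEI

universe u v

section BinomialIdeals

variable {σ : Type u} {F : Type v} [Field F]

lemma binomial_self (a : σ →₀ ℕ) : binomial F a a = 0 := sub_self _

lemma neg_binomial (a b : σ →₀ ℕ) : -binomial F a b = binomial F b a := neg_sub _ _

lemma binomial_add_binomial (a b c : σ →₀ ℕ) :
    binomial F a b + binomial F b c = binomial F a c := sub_add_sub_cancel _ _ _

lemma monomial_mul_binomial (c a b : σ →₀ ℕ) :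
    monomial c 1 * binomial F a b = binomial F (c + a) (c + b) := by
  simp [binomial, mul_sub, monomial_mul]

lemma coeff_binomial_left {a b : σ →₀ ℕ} (h : a ≠ b) : (binomial F a b).coeff a = 1 := by
  classical
  simp [binomial, coeff_monomial, h.symm]

lemma binomial_ne_zero {a b : σ →₀ ℕ} (h : a ≠ b) : binomial F a b ≠ 0 := fun h0 => by
  simpa [h0] using coeff_binomial_left (F := F) h

lemma eq_or_eq_of_mem_support_binomial {a b c : σ →₀ ℕ} (h : c ∈ (binomial F a b).support) :
    c = a ∨ c = b := by
  classical
  simpa using Finset.union_subset_union support_monomial_subset support_monomial_subset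
    (support_sub _ _ _ h)

/-- The congruence on exponents whose classes are the fibres of the monomials modulo `I`. -/
def exponentCon (I : Ideal (MvPolynomial σ F)) : AddCon (σ →₀ ℕ) where
  r a b := binomial F a b ∈ I
  iseqv :=
    { refl := fun a => by simp [binomial_self]
      symm := fun h => by simpa [neg_binomial] using I.neg_mem h
      trans := fun h h' => by simpa [binomial_add_binomial] using I.add_mem h h' }
  add' {a b c d} h h' := by
    have := I.add_mem (I.mul_mem_left (monomial c 1) h) (I.mul_mem_left (monomial b 1) h')
    rwa [monomial_mul_binomial, monomial_mul_binomial, add_comm c b, binomial_add_binomial,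
      add_comm c a] at this

/-- An ideal generated by pure difference binomials. -/
def IsBinomialIdeal (I : Ideal (MvPolynomial σ F)) : Prop :=
  ∃ S : Set (MvPolynomial σ F), (∀ s ∈ S, ∃ a b, s = binomial F a b) ∧ I = Ideal.span S

lemma span_le_ker_mapDomainRingHom {c : AddCon (σ →₀ ℕ)} {S : Set (MvPolynomial σ F)}
    (hS : ∀ s ∈ S, ∃ a b, s = binomial F a b ∧ c a b) :
    Ideal.span S ≤ RingHom.ker (AddMonoidAlgebra.mapDomainRingHom F c.mk') := by
  refine Ideal.span_le.mpr fun s hs => ?_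
  obtain ⟨a, b, rfl, hab⟩ := hS s hs
  have hq : c.mk' a = c.mk' b := c.eq.mpr hab
  have hmap (d : σ →₀ ℕ) : AddMonoidAlgebra.mapDomainRingHom F c.mk' (monomial d 1) =
      AddMonoidAlgebra.single (c.mk' d) 1 := AddMonoidAlgebra.mapDomain_single
  rw [SetLike.mem_coe, RingHom.mem_ker, binomial, map_sub, hmap, hmap, hq, sub_self]

/-- The image of `f` in the monoid algebra of the quotient by `c` vanishes, so the coefficients
of `f` sum to zero over each class. -/
lemma exists_con_of_mem_support {c : AddCon (σ →₀ ℕ)} {S : Set (MvPolynomial σ F)}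
    (hS : ∀ s ∈ S, ∃ a b, s = binomial F a b ∧ c a b) {f : MvPolynomial σ F}
    (hf : f ∈ Ideal.span S) {a : σ →₀ ℕ} (ha : a ∈ f.support) :
    ∃ b ∈ f.support, b ≠ a ∧ c a b := by
  classical
  by_contra! H
  have hzero : Finsupp.mapDomain c.mk' (AddMonoidAlgebra.coeff f) (c.mk' a) = 0 :=
    DFunLike.congr_fun
      (congrArg AddMonoidAlgebra.coeff (span_le_ker_mapDomainRingHom hS hf)) (c.mk' a)
  rw [Finsupp.mapDomain, Finsupp.sum_apply, Finsupp.sum, finsupp_support_eq_support,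
    Finset.sum_eq_single_of_mem a ha, Finsupp.single_eq_same] at hzero
  · exact mem_support_iff.mp ha hzero
  · intro b hb hba
    exact Finsupp.single_eq_of_ne fun hq => H b hb hba (c.eq.mp hq)

lemma con_of_binomial_mem_span {c : AddCon (σ →₀ ℕ)} {S : Set (MvPolynomial σ F)}
    (hS : ∀ s ∈ S, ∃ a b, s = binomial F a b ∧ c a b) {a b : σ →₀ ℕ}
    (h : binomial F a b ∈ Ideal.span S) : c a b := by
  obtain rfl | hab := eq_or_ne a b
  · exact c.refl a
  obtain ⟨d, hd, hda, had⟩ := exists_con_of_mem_support hS h (a := a)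
    (by simp [mem_support_iff, coeff_binomial_left hab])
  obtain rfl := (eq_or_eq_of_mem_support_binomial hd).resolve_left hda
  exact had

lemma IsBinomialIdeal.exists_binomial_mem {I : Ideal (MvPolynomial σ F)} (hI : IsBinomialIdeal I)
    {f : MvPolynomial σ F} (hf : f ∈ I) {a : σ →₀ ℕ} (ha : a ∈ f.support) :
    ∃ b ∈ f.support, b ≠ a ∧ binomial F a b ∈ I := by
  obtain ⟨S, hS, rfl⟩ := hI
  refine exists_con_of_mem_support (c := exponentCon (Ideal.span S)) (fun s hs => ?_) hf ha
  obtain ⟨a, b, rfl⟩ := hS s hs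
  exact ⟨a, b, rfl, Ideal.subset_span hs⟩

lemma exists_isPrimitive_le {I : Ideal (MvPolynomial σ F)} {a b : σ →₀ ℕ} (hab : a ≠ b)
    (h : binomial F a b ∈ I) : ∃ a' ≤ a, ∃ b' ≤ b, IsPrimitive I a' b' := by
  obtain ⟨⟨a', b'⟩, ⟨ha, hb⟩, hmin⟩ := exists_minimal_le_of_wellFoundedLT
    (fun p : (σ →₀ ℕ) × (σ →₀ ℕ) => p.1 ≠ p.2 ∧ binomial F p.1 p.2 ∈ I) (a, b) ⟨hab, h⟩
  refine ⟨a', ha, b', hb, hmin.prop.1, hmin.prop.2, fun a₀ b₀ hne hmem ha₀ hb₀ => ?_⟩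
  exact Prod.mk.inj (hmin.eq_of_ge (y := (a₀, b₀)) ⟨hne, hmem⟩ ⟨ha₀, hb₀⟩).symm

end BinomialIdeals

section ReducedGroebnerBases

variable {σ : Type u} {F : Type v} [Field F] {m : MonomialOrder.{u, u} σ}
  {I : Ideal (MvPolynomial σ F)} {B : Set (MvPolynomial σ F)}

/-- The exponent `c` is standard if it is not divisible by the leading exponent of a nonzero
element of `I`. -/
def IsStandard (m : MonomialOrder.{u, u} σ) (I : Ideal (MvPolynomial σ F)) (c : σ →₀ ℕ) : Prop :=
  ∀ g ∈ I, g ≠ 0 → ¬ m.degree g ≤ c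

lemma not_isStandard_degree {f : MvPolynomial σ F} (hf : f ∈ I) (hf0 : f ≠ 0) :
    ¬ IsStandard m I (m.degree f) := fun h => h f hf hf0 le_rfl

lemma eq_zero_of_forall_isStandard {f : MvPolynomial σ F} (hf : f ∈ I)
    (h : ∀ c ∈ f.support, IsStandard m I c) : f = 0 := by
  by_contra hf0
  exact not_isStandard_degree hf hf0 (h _ (m.degree_mem_support hf0))

lemma toSyn_lt_degree {f : MvPolynomial σ F} {c : σ →₀ ℕ} (hc : c ∈ f.support)
    (hne : c ≠ m.degree f) : m.toSyn c < m.toSyn (m.degree f) :=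
  (m.le_degree hc).lt_of_ne (m.toSyn.injective.ne hne)

lemma degree_binomial {a b : σ →₀ ℕ} (h : m.toSyn b < m.toSyn a) :
    m.degree (binomial F a b) = a := by
  classical
  have hlt : m.toSyn (m.degree (monomial b (1 : F))) <
      m.toSyn (m.degree (monomial a (1 : F))) := by
    simpa [MonomialOrder.degree_monomial] using h
  simpa [binomial, MonomialOrder.degree_monomial] using m.degree_sub_of_lt hlt

lemma isGroebnerBasis_iff_of_monic (hB : ∀ b ∈ B, m.Monic b) :
    IsGroebnerBasis m I B ↔ B.Finite ∧ B ⊆ (I : Set (MvPolynomial σ F)) ∧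
      ∀ f ∈ I, f ≠ 0 → ∃ b ∈ B, m.degree b ≤ m.degree f := by
  have hspan : Ideal.span (m.leadingTerm '' B) =
      Ideal.span ((fun s => monomial s (1 : F)) '' (m.degree '' B)) := by
    rw [Set.image_image]
    congr 1
    refine Set.image_congr fun b hb => ?_
    rw [MonomialOrder.leadingTerm, (hB b hb).leadingCoeff_eq_one]
  refine and_congr_right fun _ => and_congr_right fun hsub => ⟨fun h f hf hf0 => ?_, fun h => ?_⟩
  · have hmem : m.leadingTerm f ∈ Ideal.span (m.leadingTerm '' B) :=
      h ▸ Ideal.subset_span ⟨f, hf, rfl⟩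
    rw [hspan, mem_ideal_span_monomial_image] at hmem
    simpa using hmem (m.degree f) (by simp [m.support_leadingTerm' hf0])
  · refine le_antisymm (Ideal.span_mono (Set.image_mono hsub)) (Ideal.span_le.mpr ?_)
    rintro _ ⟨f, hf, rfl⟩
    rw [SetLike.mem_coe, hspan, mem_ideal_span_monomial_image]
    intro c hc
    have hf0 : f ≠ 0 := fun hf0 => by simp [hf0] at hc
    obtain rfl : c = m.degree f := by simpa [m.support_leadingTerm' hf0] using hc
    simpa using h f hf hf0

lemma exists_sub_mem_forall_isStandard (m : MonomialOrder.{u, u} σ) (I : Ideal (MvPolynomial σ F))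
    (f : MvPolynomial σ F) : ∃ r, f - r ∈ I ∧ ∀ c ∈ r.support, IsStandard m I c := by
  obtain ⟨q, r, hf, -, hr⟩ := m.div_set (B := {g | g ∈ I ∧ g ≠ 0})
    (fun g hg => (m.leadingCoeff_ne_zero_iff.mpr hg.2).isUnit) f
  refine ⟨r, ?_, fun c hc g hg hg0 => hr c hc g ⟨hg, hg0⟩⟩
  rw [hf, add_sub_cancel_right, Finsupp.linearCombination_apply]
  exact I.sum_mem fun g _ => I.mul_mem_left _ g.2.1

lemma exists_monic_degree_eq {a : σ →₀ ℕ} (ha : ¬ IsStandard m I a) :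
    ∃ h ∈ I, m.Monic h ∧ m.degree h = a ∧ ∀ c ∈ h.support, c ≠ a → IsStandard m I c := by
  classical
  obtain ⟨r, hr, hstd⟩ := exists_sub_mem_forall_isStandard m I (monomial a 1)
  have hcoeff : (monomial a 1 - r).coeff a = 1 := by
    have : r.coeff a = 0 := notMem_support_iff.mp fun har => ha (hstd a har)
    simp [this]
  have hne : monomial a 1 - r ≠ 0 := fun h0 => by simp [h0] at hcoeff
  have hstd' : ∀ c ∈ (monomial a 1 - r).support, c ≠ a → IsStandard m I c := by
    intro c hc hca
    have : c ∉ (monomial a (1 : F)).support := fun h =>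
      hca (Finset.mem_singleton.mp (support_monomial_subset h))
    exact hstd c ((Finset.mem_union.mp (support_sub _ _ _ hc)).resolve_left this)
  have hdeg : m.degree (monomial a 1 - r) = a := by
    by_contra hda
    exact not_isStandard_degree hr hne (hstd' _ (m.degree_mem_support hne) hda)
  exact ⟨_, hr, by rw [MonomialOrder.Monic, MonomialOrder.leadingCoeff, hdeg, hcoeff], hdeg, hstd'⟩

/-- The leading exponents of a reduced Gröbner basis are the minimal nonstandard exponents, of
which there are finitely many by Dickson's lemma. -/
theorem exists_isReducedGroebnerBasis [Finite σ] (m : MonomialOrder.{u, u} σ)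
    (I : Ideal (MvPolynomial σ F)) : ∃ B, IsReducedGroebnerBasis m I B := by
  choose! h hmem hmonic hdeg hstd using fun a : σ →₀ ℕ => exists_monic_degree_eq (m := m) (I := I)
    (a := a)
  let M : Set (σ →₀ ℕ) := {a | Minimal (fun c => ¬ IsStandard m I c) a}
  have hM : ∀ a ∈ M, Minimal (fun c => ¬ IsStandard m I c) a := fun _ ha => ha
  have hmonicM : ∀ b ∈ h '' M, m.Monic b := by
    rintro _ ⟨a, ha, rfl⟩
    exact hmonic a (hM a ha).prop
  refine ⟨h '' M, (isGroebnerBasis_iff_of_monic hmonicM).mpr ⟨?_, ?_, ?_⟩, hmonicM, ?_⟩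
  · exact (WellQuasiOrderedLE.finite_of_isAntichain (setOfPred_minimal_antichain _)).image h
  · rintro _ ⟨a, ha, rfl⟩
    exact hmem a (hM a ha).prop
  · intro f hf hf0
    obtain ⟨a, hle, ha⟩ := exists_minimal_le_of_wellFoundedLT (fun c => ¬ IsStandard m I c)
      (m.degree f) (not_isStandard_degree hf hf0)
    exact ⟨h a, ⟨a, ha, rfl⟩, (hdeg a ha.prop).trans_le hle⟩
  · rintro _ ⟨a, ha, rfl⟩ d hd _ ⟨a', ha', rfl⟩ hne hle
    rw [hdeg a' (hM a' ha').prop] at hle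
    by_cases hda : d = a
    · subst hda
      exact hne (congrArg h ((hM d ha).eq_of_le (hM a' ha').prop hle))
    · refine (hM a' ha').prop fun g hg hg0 hga => ?_
      exact hstd a (hM a ha).prop d hd hda g hg hg0 (hga.trans hle)

namespace IsReducedGroebnerBasis

lemma exists_degree_le (hB : IsReducedGroebnerBasis m I B) {f : MvPolynomial σ F} (hf : f ∈ I)
    (hf0 : f ≠ 0) : ∃ b ∈ B, m.degree b ≤ m.degree f :=
  ((isGroebnerBasis_iff_of_monic hB.2.1).mp hB.1).2.2 f hf hf0

lemma isStandard_of_mem_support (hB : IsReducedGroebnerBasis m I B) {f : MvPolynomial σ F}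
    (hf : f ∈ B) {c : σ →₀ ℕ} (hc : c ∈ f.support) (hne : c ≠ m.degree f) :
    IsStandard m I c := by
  intro g hg hg0 hle
  obtain ⟨h, hh, hhg⟩ := hB.exists_degree_le hg hg0
  obtain rfl : h = f := by
    by_contra hhf
    exact hB.2.2 f hf c hc h hh hhf (hhg.trans hle)
  exact (toSyn_lt_degree hc hne).not_ge (m.toSyn_monotone (hhg.trans hle))

lemma exists_eq_binomial (hB : IsReducedGroebnerBasis m I B) (hI : IsBinomialIdeal I)
    {f : MvPolynomial σ F} (hf : f ∈ B) :
    ∃ a b, f = binomial F a b ∧ m.toSyn b < m.toSyn a := by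
  classical
  have hfI := hB.1.2.1 hf
  have hmonic := hB.2.1 f hf
  have hdeg := m.degree_mem_support hmonic.ne_zero
  obtain ⟨b, hb, hba, hbin⟩ := hI.exists_binomial_mem hfI hdeg
  refine ⟨m.degree f, b, sub_eq_zero.mp (eq_zero_of_forall_isStandard (m := m)
    (I.sub_mem hfI hbin) fun c hc => ?_), toSyn_lt_degree hb hba⟩
  have hcf : c ∈ f.support := by
    rcases Finset.mem_union.mp (support_sub _ _ _ hc) with hc | hc
    · exact hc
    · rcases eq_or_eq_of_mem_support_binomial hc with rfl | rfl <;> assumption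
  refine hB.isStandard_of_mem_support hf hcf ?_
  rintro rfl
  simp [coeff_binomial_left hba.symm, hmonic.coeff_degree] at hc

lemma isPrimitive (hB : IsReducedGroebnerBasis m I B) {a b : σ →₀ ℕ} (hf : binomial F a b ∈ B)
    (hlt : m.toSyn b < m.toSyn a) : IsPrimitive I a b := by
  classical
  have hab : a ≠ b := ne_of_apply_ne m.toSyn hlt.ne'
  have hmem := hB.1.2.1 hf
  have hdeg := degree_binomial (F := F) hlt
  have hb : IsStandard m I b := by
    refine hB.isStandard_of_mem_support hf ?_ (by rw [hdeg]; exact hab.symm)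
    simp [binomial, coeff_monomial, mem_support_iff, hab]
  have hle_of_lt : ∀ c d, binomial F c d ∈ I → m.toSyn d < m.toSyn c → ¬ c ≤ b := by
    intro c d hcd hlt
    have := hb _ hcd (binomial_ne_zero (ne_of_apply_ne m.toSyn hlt.ne'))
    rwa [degree_binomial hlt] at this
  refine ⟨hab, hmem, fun a' b' hne hmem' ha' hb' => ?_⟩
  have hba' : m.toSyn b' < m.toSyn a' := by
    refine (le_of_not_gt fun hlt' => ?_).lt_of_ne (m.toSyn.injective.ne hne.symm)
    exact hle_of_lt b' a' ((exponentCon I).symm hmem') hlt' hb'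
  have haa : a' = a := by
    obtain ⟨g, hg, hga⟩ := hB.exists_degree_le hmem' (binomial_ne_zero hne)
    rw [degree_binomial hba'] at hga
    obtain rfl : g = binomial F a b := by
      by_contra hgf
      refine hB.2.2 _ hf a ?_ g hg hgf (hga.trans ha')
      simp [mem_support_iff, coeff_binomial_left hab]
    exact ha'.antisymm (hdeg ▸ hga)
  subst haa
  refine ⟨rfl, ?_⟩
  by_contra hbb
  exact hle_of_lt b b' ((exponentCon I).trans ((exponentCon I).symm hmem) hmem')
    (m.toSyn_strictMono (hb'.lt_of_ne hbb)) le_rfl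

end IsReducedGroebnerBasis

theorem universalGroebnerBasis_subset_graverBasis (hI : IsBinomialIdeal I) :
    universalGroebnerBasis I ⊆ graverBasis I := by
  rintro f ⟨m, B, hB, hf⟩
  obtain ⟨a, b, rfl, hlt⟩ := hB.exists_eq_binomial hI hf
  exact ⟨a, b, hB.isPrimitive hf hlt, rfl⟩

end ReducedGroebnerBases

section Exponents

variable {V : Type u} {T T' : Set V} {l l' : List V} {i j i' j' : V}

/-- The exponent of `x_i y_j`. -/
noncomputable def edgeExponent (i j : V) : V ⊕ V →₀ ℕ :=
  Finsupp.single (Sum.inl i) 1 + Finsupp.single (Sum.inr j) 1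

open Classical in
/-- The exponent of the product over `k ∈ l` of the variables `t_k`, where the choice between `x_k`
and `y_k` is encoded by the set `T` of those `k` with `t_k = x_k`. -/
noncomputable def listExponent (T : Set V) (l : List V) : V ⊕ V →₀ ℕ :=
  (l.map fun k => Finsupp.single (if k ∈ T then Sum.inl k else Sum.inr k) 1).sum

/-- The exponent of the first term of `t_{k_1} ⋯ t_{k_r} (x_i y_j - x_j y_i)` for
`l = [k_1, …, k_r]`; the second term has exponent `pathExponent T l j i`. -/
noncomputable def pathExponent (T : Set V) (l : List V) (i j : V) : V ⊕ V →₀ ℕ :=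
  listExponent T l + edgeExponent i j

/-- The degree of an exponent in the two variables at the vertex `k`. -/
def vertexDegree (a : V ⊕ V →₀ ℕ) (k : V) : ℕ := a (Sum.inl k) + a (Sum.inr k)

lemma vertexDegree_add (a b : V ⊕ V →₀ ℕ) (k : V) :
    vertexDegree (a + b) k = vertexDegree a k + vertexDegree b k :=
  add_add_add_comm _ _ _ _

lemma vertexDegree_mono {a b : V ⊕ V →₀ ℕ} (h : a ≤ b) (k : V) :
    vertexDegree a k ≤ vertexDegree b k :=
  add_le_add (h _) (h _)

lemma eq_of_le_of_vertexDegree_le {a b : V ⊕ V →₀ ℕ} (h : a ≤ b)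
    (hdeg : ∀ k, vertexDegree b k ≤ vertexDegree a k) : a = b := by
  ext (k | k) <;>
  · have := hdeg k
    have := h (Sum.inl k)
    have := h (Sum.inr k)
    simp only [vertexDegree] at *
    omega

open Classical in
lemma edgeExponent_inl (i j k : V) : edgeExponent i j (Sum.inl k) = if k = i then 1 else 0 := by
  simp [edgeExponent, Finsupp.single_apply, eq_comm]

open Classical in
lemma edgeExponent_inr (i j k : V) : edgeExponent i j (Sum.inr k) = if k = j then 1 else 0 := by
  simp [edgeExponent, Finsupp.single_apply, eq_comm]

open Classical in
lemma vertexDegree_edgeExponent (i j k : V) :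
    vertexDegree (edgeExponent i j) k = (if k = i then 1 else 0) + if k = j then 1 else 0 := by
  rw [vertexDegree, edgeExponent_inl, edgeExponent_inr]

lemma vertexDegree_edgeExponent_comm (i j k : V) :
    vertexDegree (edgeExponent i j) k = vertexDegree (edgeExponent j i) k := by
  rw [vertexDegree_edgeExponent, vertexDegree_edgeExponent, add_comm]

open Classical in
lemma listExponent_inl (T : Set V) (l : List V) (k : V) :
    listExponent T l (Sum.inl k) = if k ∈ T then l.count k else 0 := by
  induction l with
  | nil => simp [listExponent]
  | cons v l ih =>
    rw [listExponent, List.map_cons, List.sum_cons, Finsupp.add_apply, ← listExponent, ih,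
      Finsupp.single_apply, List.count_cons]
    grind

open Classical in
lemma listExponent_inr (T : Set V) (l : List V) (k : V) :
    listExponent T l (Sum.inr k) = if k ∈ T then 0 else l.count k := by
  induction l with
  | nil => simp [listExponent]
  | cons v l ih =>
    rw [listExponent, List.map_cons, List.sum_cons, Finsupp.add_apply, ← listExponent, ih,
      Finsupp.single_apply, List.count_cons]
    grind

open Classical in
lemma pathExponent_inl (T : Set V) (l : List V) (i j k : V) :
    pathExponent T l i j (Sum.inl k) =
      (if k ∈ T then l.count k else 0) + if k = i then 1 else 0 := by
  rw [pathExponent, Finsupp.add_apply, listExponent_inl, edgeExponent_inl]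

open Classical in
lemma pathExponent_inr (T : Set V) (l : List V) (i j k : V) :
    pathExponent T l i j (Sum.inr k) =
      (if k ∈ T then 0 else l.count k) + if k = j then 1 else 0 := by
  rw [pathExponent, Finsupp.add_apply, listExponent_inr, edgeExponent_inr]

open Classical in
lemma vertexDegree_pathExponent (T : Set V) (l : List V) (i j k : V) :
    vertexDegree (pathExponent T l i j) k = (i :: (l ++ [j])).count k := by
  rw [vertexDegree, pathExponent_inl, pathExponent_inr]
  simp only [List.count_cons, List.count_append, List.count_nil]
  grind

lemma pathExponent_ne_swap (hij : i ≠ j) : pathExponent T l i j ≠ pathExponent T l j i := by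
  intro h
  have := DFunLike.congr_fun h (Sum.inl i)
  simp [pathExponent_inl, hij] at this

lemma pathExponent_le {a : V ⊕ V →₀ ℕ} (hl : l.Nodup) (hi : i ∉ l) (hj : j ∉ l)
    (hx : ∀ k ∈ l, k ∈ T → 0 < a (Sum.inl k)) (hy : ∀ k ∈ l, k ∉ T → 0 < a (Sum.inr k))
    (hai : 0 < a (Sum.inl i)) (haj : 0 < a (Sum.inr j)) : pathExponent T l i j ≤ a := by
  classical
  rintro (k | k)
  · have := hx k
    rw [pathExponent_inl, hl.count]
    grind
  · have := hy k
    rw [pathExponent_inr, hl.count]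
    grind

lemma mem_or_eq_of_pathExponent_le (h : pathExponent T' l' i' j' ≤ pathExponent T l i j) :
    (i' ∈ l ∧ i' ∈ T ∨ i' = i) ∧ (j' ∈ l ∧ j' ∉ T ∨ j' = j) := by
  have hi := h (Sum.inl i')
  have hj := h (Sum.inr j')
  rw [pathExponent_inl, pathExponent_inl, if_pos (rfl : i' = i')] at hi
  rw [pathExponent_inr, pathExponent_inr, if_pos (rfl : j' = j')] at hj
  grind [List.count_eq_zero]

variable (F : Type v) [Field F]

lemma edge_eq_binomial (i j : V) :
    x F i * y F j - x F j * y F i = binomial F (edgeExponent i j) (edgeExponent j i) := by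
  simp [x, y, X, binomial, monomial_mul, edgeExponent]

open Classical in
lemma prod_map_ite (T : Set V) (l : List V) :
    (l.map fun k => if k ∈ T then x F k else y F k).prod = monomial (listExponent T l) 1 := by
  induction l with
  | nil => simp [listExponent]
  | cons v l ih =>
    have hv : (if v ∈ T then x F v else y F v) =
        monomial (Finsupp.single (if v ∈ T then Sum.inl v else Sum.inr v) 1) 1 :=
      (apply_ite X _ _ _).symm
    rw [List.map_cons, List.prod_cons, ih, hv, monomial_mul, mul_one, listExponent, listExponent,
      List.map_cons, List.sum_cons]

open Classical in
lemma prod_map_ite_mul_edge (T : Set V) (l : List V) (i j : V) :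
    (l.map fun k => if k ∈ T then x F k else y F k).prod * (x F i * y F j - x F j * y F i) =
      binomial F (pathExponent T l i j) (pathExponent T l j i) := by
  rw [prod_map_ite, edge_eq_binomial, monomial_mul_binomial, pathExponent, pathExponent]

end Exponents

section Walks

variable {V : Type u} {G : SimpleGraph V} {i j : V} {F : Type v} [Field F]

/-- The vertices `i_1, …, i_{r-1}` of a walk `i_0, …, i_r`, in this order. -/
def innerVertices (p : G.Walk i j) : List V := p.support.tail.dropLast

lemma support_eq_cons_innerVertices_append (p : G.Walk i j) (hij : i ≠ j) :
    p.support = i :: (innerVertices p ++ [j]) := by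
  cases p with
  | nil => exact absurd rfl hij
  | cons h q =>
    have := List.dropLast_append_getLast q.support_ne_nil
    rw [q.getLast_support] at this
    simp [innerVertices, this]

lemma mem_support_of_mem_innerVertices {p : G.Walk i j} {k : V} (hk : k ∈ innerVertices p) :
    k ∈ p.support :=
  List.mem_of_mem_tail (List.mem_of_mem_dropLast hk)

lemma nodup_innerVertices {p : G.Walk i j} (hp : p.support.Nodup) (hij : i ≠ j) :
    (innerVertices p).Nodup ∧ i ∉ innerVertices p ∧ j ∉ innerVertices p := by
  rw [support_eq_cons_innerVertices_append p hij] at hp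
  grind

lemma innerVertices_cons {k : V} (h : G.Adj i k) (q : G.Walk k j) (hkj : k ≠ j) :
    innerVertices (SimpleGraph.Walk.cons h q) = k :: innerVertices q := by
  rw [innerVertices, SimpleGraph.Walk.support_cons, List.tail_cons,
    support_eq_cons_innerVertices_append q hkj, ← List.cons_append, List.dropLast_concat]

open scoped Classical in
lemma vertexDegree_pathExponent_innerVertices (T : Set V) (p : G.Walk i j) (hij : i ≠ j) (k : V) :
    vertexDegree (pathExponent T (innerVertices p) i j) k = p.support.count k := by
  rw [vertexDegree_pathExponent, support_eq_cons_innerVertices_append p hij]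

lemma edge_mem_binomialEdgeIdeal (h : G.Adj i j) :
    x F i * y F j - x F j * y F i ∈ binomialEdgeIdeal F G :=
  Ideal.subset_span ⟨i, j, h, rfl⟩

lemma prod_map_mul_edge_mem {t : V → MvPolynomial (V ⊕ V) F} (ht : ∀ k, t k = x F k ∨ t k = y F k)
    (p : G.Walk i j) :
    ((innerVertices p).map t).prod * (x F i * y F j - x F j * y F i) ∈ binomialEdgeIdeal F G := by
  induction p with
  | nil => simp
  | @cons i k j h q ih =>
    have hedge := edge_mem_binomialEdgeIdeal (F := F) h
    obtain rfl | hkj := eq_or_ne k j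
    · exact Ideal.mul_mem_left _ _ hedge
    rw [innerVertices_cons h q hkj, List.map_cons, List.prod_cons]
    set P := ((innerVertices q).map t).prod
    rcases ht k with hk | hk
    · have hcombine : t k * P * (x F i * y F j - x F j * y F i) =
          x F i * (P * (x F k * y F j - x F j * y F k)) +
            P * x F j * (x F i * y F k - x F k * y F i) := by rw [hk]; ring
      rw [hcombine]
      exact Ideal.add_mem _ (Ideal.mul_mem_left _ _ ih) (Ideal.mul_mem_left _ _ hedge)
    · have hcombine : t k * P * (x F i * y F j - x F j * y F i) =
          y F i * (P * (x F k * y F j - x F j * y F k)) +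
            P * y F j * (x F i * y F k - x F k * y F i) := by rw [hk]; ring
      rw [hcombine]
      exact Ideal.add_mem _ (Ideal.mul_mem_left _ _ ih) (Ideal.mul_mem_left _ _ hedge)

variable (F) in
lemma binomial_pathExponent_mem (T : Set V) (p : G.Walk i j) :
    binomial F (pathExponent T (innerVertices p) i j) (pathExponent T (innerVertices p) j i) ∈
      binomialEdgeIdeal F G := by
  classical
  rw [← prod_map_ite_mul_edge]
  exact prod_map_mul_edge_mem (fun k => ite_eq_or_eq _ _ _) p

lemma mem_pathBinomials_iff {f : MvPolynomial (V ⊕ V) F} :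
    f ∈ pathBinomials F G ↔ ∃ (i j : V) (p : G.Walk i j) (T : Set V), i ≠ j ∧
      WeaklyAdmissible p ∧ f = binomial F (pathExponent T (innerVertices p) i j)
        (pathExponent T (innerVertices p) j i) := by
  classical
  constructor
  · rintro ⟨hf, i, j, p, hp, t, ht, rfl⟩
    obtain ⟨T, rfl⟩ : ∃ T : Set V, t = fun k => if k ∈ T then x F k else y F k := by
      refine ⟨{k | t k = x F k}, funext fun k => ?_⟩
      have := ht k
      grind
    refine ⟨i, j, p, T, ?_, hp, by rw [← prod_map_ite_mul_edge, innerVertices]⟩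
    rintro rfl
    simp at hf
  · rintro ⟨i, j, p, T, hij, hp, rfl⟩
    exact ⟨binomial_ne_zero (pathExponent_ne_swap hij), i, j, p, hp, _,
      fun k => ite_eq_or_eq _ _ _, (prod_map_ite_mul_edge F T (innerVertices p) i j).symm⟩

variable (G F) in
lemma isBinomialIdeal_binomialEdgeIdeal : IsBinomialIdeal (binomialEdgeIdeal F G) := by
  refine ⟨_, ?_, rfl⟩
  rintro _ ⟨i, j, -, rfl⟩
  exact ⟨_, _, edge_eq_binomial F i j⟩

end Walks

section Congruence

lemma weight_lt_weight {σ : Type u} {w : σ → ℕ} {a b : σ →₀ ℕ} {s : σ}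
    (hle : ∀ r, a r * w r ≤ b r * w r) (hlt : a s * w s < b s * w s) :
    Finsupp.weight w a < Finsupp.weight w b := by
  classical
  have hsum (c : σ →₀ ℕ) (hc : c.support ⊆ a.support ∪ b.support) :
      Finsupp.weight w c = ∑ r ∈ a.support ∪ b.support, c r * w r := by
    simpa using (Finsupp.weight_apply w c).trans
      (Finsupp.sum_of_support_subset c hc (fun r n => n • w r) (by simp))
  rw [hsum a Finset.subset_union_left, hsum b Finset.subset_union_right]
  refine Finset.sum_lt_sum (fun r _ => hle r) ⟨s, ?_, hlt⟩
  have : b s ≠ 0 := fun h => by simp [h] at hlt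
  simp [this]

variable {V : Type u} {G : SimpleGraph V} {a b : V ⊕ V →₀ ℕ} {i j : V}

/-- Congruence of exponents with the same degree at every vertex and the same degree in the
`x`-variables on every connected component of the graph induced on the support. Functions that are
constant on these components stand for the components themselves, so that no quotient is needed. -/
def componentCon (G : SimpleGraph V) : AddCon (V ⊕ V →₀ ℕ) where
  r a b := (∀ k, vertexDegree a k = vertexDegree b k) ∧ ∀ w : V → ℕ,
    (∀ k l, G.Adj k l → 0 < vertexDegree a k → 0 < vertexDegree a l → w k = w l) →
      Finsupp.weight (Sum.elim w 0) a = Finsupp.weight (Sum.elim w 0) b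
  iseqv :=
    { refl := fun _ => ⟨fun _ => rfl, fun _ _ => rfl⟩
      symm := fun h =>
        ⟨fun k => (h.1 k).symm, fun w hw => (h.2 w (by simpa only [h.1] using hw)).symm⟩
      trans := fun h h' => ⟨fun k => (h.1 k).trans (h'.1 k), fun w hw =>
        (h.2 w hw).trans (h'.2 w (by simpa only [h.1] using hw))⟩ }
  add' {a b c d} h h' := by
    refine ⟨fun k => by rw [vertexDegree_add, vertexDegree_add, h.1, h'.1], fun w hw => ?_⟩
    simp only [vertexDegree_add] at hw
    rw [map_add, map_add, h.2 w fun k l hkl hk hl => hw k l hkl (by omega) (by omega),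
      h'.2 w fun k l hkl hk hl => hw k l hkl (by omega) (by omega)]

lemma componentCon_edgeExponent (h : G.Adj i j) :
    componentCon G (edgeExponent i j) (edgeExponent j i) := by
  refine ⟨vertexDegree_edgeExponent_comm i j, fun w hw => ?_⟩
  have hij : w i = w j := hw i j h (by simp [vertexDegree_edgeExponent])
    (by simp [vertexDegree_edgeExponent])
  simp [edgeExponent, Finsupp.weight_single, hij]

lemma componentCon_of_binomial_mem {F : Type v} [Field F]
    (h : binomial F a b ∈ binomialEdgeIdeal F G) : componentCon G a b := by
  refine con_of_binomial_mem_span ?_ h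
  rintro _ ⟨i, j, hij, rfl⟩
  exact ⟨_, _, edge_eq_binomial F i j, componentCon_edgeExponent hij⟩

/-- A walk inside the support of `a` along which `a` can lose an `x` at the start and gain an `x`
at the end while moving towards `b`. -/
structure IsExchangeWalk (a b : V ⊕ V →₀ ℕ) (p : G.Walk i j) : Prop where
  lt_start : b (Sum.inl i) < a (Sum.inl i)
  lt_end : a (Sum.inl j) < b (Sum.inl j)
  vertexDegree_pos : ∀ k ∈ p.support, 0 < vertexDegree a k

lemma IsExchangeWalk.of_support_subset {p q : G.Walk i j} (hp : IsExchangeWalk a b p)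
    (h : q.support ⊆ p.support) : IsExchangeWalk a b q :=
  ⟨hp.lt_start, hp.lt_end, fun k hk => hp.vertexDegree_pos k (h hk)⟩

/-- Otherwise the vertices reachable from `i` inside the support would form a component on which
`a` has a larger `x`-degree than `b`. -/
lemma exists_exchangeWalk_of_lt (h : componentCon G a b) (hi : b (Sum.inl i) < a (Sum.inl i)) :
    ∃ (j : V) (p : G.Walk i j), IsExchangeWalk a b p := by
  classical
  let Reachable (k : V) : Prop := ∃ p : G.Walk i k, ∀ v ∈ p.support, 0 < vertexDegree a v
  have hstep (k l : V) (hkl : G.Adj k l) (hl : 0 < vertexDegree a l) (hk : Reachable k) :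
      Reachable l := by
    obtain ⟨p, hp⟩ := hk
    refine ⟨p.concat hkl, fun v hv => ?_⟩
    rw [SimpleGraph.Walk.support_concat, List.mem_append, List.mem_singleton] at hv
    rcases hv with hv | rfl
    exacts [hp v hv, hl]
  by_contra! H
  have hle (k : V) (hk : Reachable k) : b (Sum.inl k) ≤ a (Sum.inl k) := by
    obtain ⟨p, hp⟩ := hk
    exact not_lt.mp fun hlt => H k p ⟨hi, hlt, hp⟩
  have hri : Reachable i :=
    ⟨.nil, by simpa [vertexDegree] using Or.inl (Nat.zero_lt_of_lt hi)⟩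
  let w (k : V) : ℕ := if Reachable k then 1 else 0
  have hlt : Finsupp.weight (Sum.elim w 0) b < Finsupp.weight (Sum.elim w 0) a := by
    refine weight_lt_weight (s := Sum.inl i) ?_ (by simpa [w, hri] using hi)
    rintro (k | k)
    · by_cases hk : Reachable k
      · simpa [w, hk] using hle k hk
      · simp [w, hk]
    · simp
  exact hlt.ne' (h.2 w fun k l hkl hk hl =>
    if_congr ⟨hstep k l hkl hl, hstep l k hkl.symm hk⟩ rfl rfl)

lemma exists_exchangeWalk (h : componentCon G a b) (hab : a ≠ b) :
    ∃ (i j : V) (p : G.Walk i j), IsExchangeWalk a b p := by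
  obtain ⟨k, hk⟩ : ∃ k, a (Sum.inl k) ≠ b (Sum.inl k) := by
    by_contra! H
    refine hab (Finsupp.ext ?_)
    rintro (k | k)
    · exact H k
    · have hk := h.1 k
      rw [vertexDegree, vertexDegree, H k] at hk
      exact Nat.add_left_cancel hk
  rcases hk.lt_or_gt with hlt | hgt
  · obtain ⟨j, p, hp⟩ := exists_exchangeWalk_of_lt ((componentCon G).symm h) hlt
    refine ⟨j, k, p.reverse, hp.lt_end, hp.lt_start, fun v hv => ?_⟩
    rw [h.1]
    exact hp.vertexDegree_pos v (by simpa using hv)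
  · exact ⟨k, exists_exchangeWalk_of_lt h hgt⟩

end Congruence

section Primitive

variable {V : Type u} {G : SimpleGraph V} {F : Type v} [Field F] {a b : V ⊕ V →₀ ℕ} {i j : V}
  {p q : G.Walk i j}

/-- An exchange walk of minimal length among all exchange walks, whatever their endpoints. -/
structure IsShortestExchangeWalk (a b : V ⊕ V →₀ ℕ) (p : G.Walk i j) : Prop extends
    IsExchangeWalk a b p where
  length_le : ∀ ⦃k l : V⦄ (q : G.Walk k l), IsExchangeWalk a b q → p.length ≤ q.length

lemma exists_isShortestExchangeWalk (h : componentCon G a b) (hab : a ≠ b) :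
    ∃ (i j : V) (p : G.Walk i j), IsShortestExchangeWalk a b p := by
  classical
  have hex : ∃ n, ∃ (i j : V) (p : G.Walk i j), IsExchangeWalk a b p ∧ p.length = n := by
    obtain ⟨i, j, p, hp⟩ := exists_exchangeWalk h hab
    exact ⟨_, i, j, p, hp, rfl⟩
  obtain ⟨i, j, p, hp, hlen⟩ := Nat.find_spec hex
  exact ⟨i, j, p, hp, fun k l q hq => hlen ▸ Nat.find_min' hex ⟨k, l, q, hq, rfl⟩⟩

namespace IsShortestExchangeWalk

lemma ne (hp : IsShortestExchangeWalk a b p) : i ≠ j := by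
  rintro rfl
  exact lt_asymm hp.lt_start hp.lt_end

lemma isPath (hp : IsShortestExchangeWalk a b p) : p.IsPath := by
  classical
  rw [← p.bypass_eq_self_of_length_le_length_bypass (hp.length_le _
    (hp.of_support_subset p.support_bypass_subset_support))]
  exact p.bypass_isPath

lemma weaklyAdmissible (hp : IsShortestExchangeWalk a b p) : WeaklyAdmissible p := by
  classical
  refine ⟨hp.isPath.support_nodup, fun q hq => hq.2 fun k hk => ?_⟩
  have hqp : q.bypass.support ⊆ p.support := fun k hk =>
    hq.1 (q.support_bypass_subset_support hk)
  have hlen := hp.length_le _ (hp.of_support_subset hqp)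
  have hperm : q.bypass.support.Perm p.support :=
    (q.bypass_isPath.support_nodup.subperm hqp).perm_of_length_le (by simpa using hlen)
  exact q.support_bypass_subset_support (hperm.symm.subset hk)

lemma apply_inl_eq (hp : IsShortestExchangeWalk a b p) {k : V} (hk : k ∈ innerVertices p) :
    a (Sum.inl k) = b (Sum.inl k) := by
  classical
  obtain ⟨-, hi, hj⟩ := nodup_innerVertices hp.isPath.support_nodup hp.ne
  have hki : k ≠ i := fun h => hi (h ▸ hk)
  have hkj : k ≠ j := fun h => hj (h ▸ hk)
  have hks := mem_support_of_mem_innerVertices hk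
  by_contra hne
  rcases lt_or_gt_of_ne hne with hlt | hgt
  · refine (SimpleGraph.Walk.length_takeUntil_lt_length hks hkj).not_ge (hp.length_le _ ?_)
    exact ⟨hp.lt_start, hlt, fun v hv =>
      hp.vertexDegree_pos v (p.support_takeUntil_subset_support hks hv)⟩
  · refine (SimpleGraph.Walk.length_dropUntil_lt_length hks hki).not_ge (hp.length_le _ ?_)
    exact ⟨hgt, hp.lt_end, fun v hv =>
      hp.vertexDegree_pos v (p.support_dropUntil_subset_support hks hv)⟩

lemma exists_pathExponent_le (hp : IsShortestExchangeWalk a b p)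
    (hdeg : ∀ k, vertexDegree a k = vertexDegree b k) :
    ∃ T, pathExponent T (innerVertices p) i j ≤ a ∧ pathExponent T (innerVertices p) j i ≤ b := by
  obtain ⟨hnodup, hi, hj⟩ := nodup_innerVertices hp.isPath.support_nodup hp.ne
  have hstart := hp.lt_start
  have hend := hp.lt_end
  have hdegi := hdeg i
  have hdegj := hdeg j
  have hinner (k : V) (hk : k ∈ innerVertices p) :
      a (Sum.inl k) = b (Sum.inl k) ∧ a (Sum.inr k) = b (Sum.inr k) ∧
        0 < a (Sum.inl k) + a (Sum.inr k) := by
    have hdegk := hdeg k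
    have hpos := hp.vertexDegree_pos k (mem_support_of_mem_innerVertices hk)
    have heq := hp.apply_inl_eq hk
    simp only [vertexDegree] at hdegk hpos
    omega
  simp only [vertexDegree] at hdegi hdegj
  refine ⟨{k | 0 < a (Sum.inl k)}, ?_, ?_⟩
  · exact pathExponent_le hnodup hi hj (by grind) (by grind) (by omega) (by omega)
  · exact pathExponent_le hnodup hj hi (by grind) (by grind) (by omega) (by omega)

end IsShortestExchangeWalk

lemma IsPrimitive.exists_weaklyAdmissible (h : IsPrimitive (binomialEdgeIdeal F G) a b) :
    ∃ (i j : V) (p : G.Walk i j) (T : Set V), i ≠ j ∧ WeaklyAdmissible p ∧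
      a = pathExponent T (innerVertices p) i j ∧ b = pathExponent T (innerVertices p) j i := by
  obtain ⟨hab, hmem, hmin⟩ := h
  have hcon := componentCon_of_binomial_mem hmem
  obtain ⟨i, j, p, hp⟩ := exists_isShortestExchangeWalk hcon hab
  obtain ⟨T, ha, hb⟩ := hp.exists_pathExponent_le hcon.1
  obtain ⟨rfl, rfl⟩ := hmin _ _ (pathExponent_ne_swap hp.ne) (binomial_pathExponent_mem F T p) ha hb
  exact ⟨i, j, p, T, hp.ne, hp.weaklyAdmissible, rfl, rfl⟩

lemma WeaklyAdmissible.listExponent_eq_of_pathExponent_le (hp : WeaklyAdmissible p) (hij : i ≠ j)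
    {T T' : Set V}
    (h : pathExponent T' (innerVertices q) i j ≤ pathExponent T (innerVertices p) i j) :
    listExponent T' (innerVertices q) = listExponent T (innerVertices p) := by
  classical
  have hcount (k : V) : q.support.count k ≤ p.support.count k := by
    rw [← vertexDegree_pathExponent_innerVertices T' q hij,
      ← vertexDegree_pathExponent_innerVertices T p hij]
    exact vertexDegree_mono h k
  have hqp : {k | k ∈ q.support} ⊆ {k | k ∈ p.support} := fun k hk =>
    List.count_pos_iff.mp ((List.count_pos_iff.mpr hk).trans_le (hcount k))
  have hpq : {k | k ∈ p.support} ⊆ {k | k ∈ q.support} := by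
    by_contra hpq
    exact hp.2 q ⟨hqp, hpq⟩
  have heq : pathExponent T' (innerVertices q) i j = pathExponent T (innerVertices p) i j := by
    refine eq_of_le_of_vertexDegree_le h fun k => ?_
    rw [vertexDegree_pathExponent_innerVertices T' q hij,
      vertexDegree_pathExponent_innerVertices T p hij, hp.1.count]
    split_ifs with hk
    exacts [List.count_pos_iff.mpr (hpq hk), Nat.zero_le _]
  exact add_right_cancel heq

lemma WeaklyAdmissible.isPrimitive (hp : WeaklyAdmissible p) (hij : i ≠ j) (T : Set V) :
    IsPrimitive (binomialEdgeIdeal F G) (pathExponent T (innerVertices p) i j)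
      (pathExponent T (innerVertices p) j i) := by
  refine ⟨pathExponent_ne_swap hij, binomial_pathExponent_mem F T p, fun a b hab hmem ha hb => ?_⟩
  obtain ⟨a', ha', b', hb', hprim⟩ := exists_isPrimitive_le hab hmem
  obtain ⟨k, l, q, T', -, -, rfl, rfl⟩ := hprim.exists_weaklyAdmissible
  obtain ⟨hk, hl⟩ := mem_or_eq_of_pathExponent_le (ha'.trans ha)
  obtain ⟨hl', hk'⟩ := mem_or_eq_of_pathExponent_le (hb'.trans hb)
  obtain rfl : k = i := by tauto
  obtain rfl : l = j := by tauto
  have hlist := hp.listExponent_eq_of_pathExponent_le hij (ha'.trans ha)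
  rw [pathExponent, hlist, ← pathExponent] at ha' hb'
  exact ⟨ha.antisymm ha', hb.antisymm hb'⟩

variable (G F) in
theorem pathBinomials_eq_graverBasis :
    pathBinomials F G = graverBasis (binomialEdgeIdeal F G) := by
  ext f
  rw [mem_pathBinomials_iff]
  constructor
  · rintro ⟨i, j, p, T, hij, hp, rfl⟩
    exact ⟨_, _, hp.isPrimitive hij T, rfl⟩
  · rintro ⟨a, b, h, rfl⟩
    obtain ⟨i, j, p, T, hij, hp, rfl, rfl⟩ := h.exists_weaklyAdmissible
    exact ⟨i, j, p, T, hij, hp, rfl⟩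

end Primitive

section MonomialOrders

lemma exists_linearOrder_lt_of_lt {α : Type u} {β : Type v} [LinearOrder β] (f : α → β) :
    ∃ _ : LinearOrder α, ∀ a b, f a < f b → a < b := by
  classical
  let : LinearOrder α := linearOrderOfSTO WellOrderingRel
  exact ⟨LinearOrder.lift' (fun a => toLex (f a, a)) fun a b h => congrArg Prod.snd h,
    fun a b h => Prod.Lex.toLex_lt_toLex.mpr (Or.inl h)⟩

variable {V : Type u} [Finite V]

lemma exists_monomialOrder_edgeExponent_lt (w : V → ℕ) :
    ∃ m : MonomialOrder.{u, u} (V ⊕ V), ∀ (c : V ⊕ V →₀ ℕ) (k l : V), w k < w l →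
      m.toSyn (c + edgeExponent k l) < m.toSyn (c + edgeExponent l k) := by
  classical
  obtain ⟨_, hlt⟩ := exists_linearOrder_lt_of_lt (β := ℕᵒᵈ)
    (Sum.elim (fun k => .toDual (w k + 1)) (fun _ => .toDual 0) : V ⊕ V → ℕᵒᵈ)
  refine ⟨MonomialOrder.lex, fun c k l hkl => ?_⟩
  rw [MonomialOrder.lex_lt_iff, Finsupp.Lex.lt_iff]
  have hne : l ≠ k := fun h => hkl.ne' (congrArg w h)
  refine ⟨Sum.inl l, ?_, by simp [edgeExponent_inl, hne]⟩
  rintro (v | v) hv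
  · have hvk : v ≠ k := by
      rintro rfl
      exact lt_asymm hv (hlt (Sum.inl l) (Sum.inl v) (by simpa using hkl))
    have hvl : v ≠ l := fun h => hv.ne (congrArg Sum.inl h)
    simp [edgeExponent_inl, hvk, hvl]
  · exact absurd hv (hlt (Sum.inl l) (Sum.inr v) (Nat.succ_pos (w l))).not_gt

lemma exists_monomialOrder_pathExponent {L : List V} {i j : V} (T : Set V) (hi : i ∉ L)
    (hj : j ∉ L) (hij : i ≠ j) :
    ∃ m : MonomialOrder.{u, u} (V ⊕ V),
      m.toSyn (pathExponent T L j i) < m.toSyn (pathExponent T L i j) ∧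
      ∀ (T' : Set V) (L' : List V) (k l : V),
        m.toSyn (pathExponent T' L' l k) < m.toSyn (pathExponent T' L' k l) →
        pathExponent T' L' k l ≤ pathExponent T L i j → k = i ∧ l = j := by
  classical
  -- `k` lies in `(L ∩ T) ∪ {i}`, where `w` is `0` or `2`, and `l` in `(L \ T) ∪ {j}`, where it is
  -- `3` or `1`. As `x_k y_l` is leading, `w l ≤ w k`, so `w k = 2` and `w l = 1`.
  let w (k : V) : ℕ := if k ∈ L then if k ∈ T then 0 else 3 else if k = j then 1 else 2
  obtain ⟨m, hm⟩ := exists_monomialOrder_edgeExponent_lt w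
  refine ⟨m, hm _ j i (by simp [w, hi, hj, hij]), fun T' L' k l hlt hle => ?_⟩
  have hw : w l ≤ w k := not_lt.mp fun h => lt_asymm hlt (hm _ k l h)
  have hends := mem_or_eq_of_pathExponent_le hle
  grind

theorem pathBinomials_subset_universalGroebnerBasis (G : SimpleGraph V) (F : Type v) [Field F] :
    pathBinomials F G ⊆ universalGroebnerBasis (binomialEdgeIdeal F G) := by
  intro f hf
  obtain ⟨i, j, p, T, hij, hp, rfl⟩ := mem_pathBinomials_iff.mp hf
  obtain ⟨-, hi, hj⟩ := nodup_innerVertices hp.1 hij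
  obtain ⟨m, hlt, hends⟩ := exists_monomialOrder_pathExponent T hi hj hij
  obtain ⟨B, hB⟩ := exists_isReducedGroebnerBasis m (binomialEdgeIdeal F G)
  obtain ⟨g, hg, hle⟩ := hB.exists_degree_le (binomial_pathExponent_mem F T p)
    (binomial_ne_zero (pathExponent_ne_swap hij))
  obtain ⟨a, b, rfl, hba⟩ := hB.exists_eq_binomial (isBinomialIdeal_binomialEdgeIdeal G F) hg
  rw [degree_binomial hlt, degree_binomial hba] at hle
  obtain ⟨k, l, q, T', -, -, rfl, rfl⟩ := (hB.isPrimitive hg hba).exists_weaklyAdmissible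
  obtain ⟨rfl, rfl⟩ := hends T' _ k l hba hle
  rw [pathExponent, pathExponent, hp.listExponent_eq_of_pathExponent_le hij hle,
    ← pathExponent, ← pathExponent] at hg
  exact ⟨m, B, hB, hg⟩

end MonomialOrders

end BEI

theorem mainTheorem1_general {V : Type*} [Finite V] {F : Type*} [Field F] (G : SimpleGraph V) :
    BEI.pathBinomials F G = BEI.universalGroebnerBasis (BEI.binomialEdgeIdeal F G) ∧
      BEI.universalGroebnerBasis (BEI.binomialEdgeIdeal F G) =
        BEI.graverBasis (BEI.binomialEdgeIdeal F G) := by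
  have hle := BEI.pathBinomials_subset_universalGroebnerBasis G F
  have hge := BEI.universalGroebnerBasis_subset_graverBasis
    (BEI.isBinomialIdeal_binomialEdgeIdeal G F)
  rw [← BEI.pathBinomials_eq_graverBasis G F] at hge ⊢
  exact ⟨hle.antisymm hge, hge.antisymm hle⟩

theorem mainTheorem1 {F : Type*} [Field F] {n : ℕ} (G : SimpleGraph (Fin n))
    (hG : G.Connected) :
    BEI.pathBinomials F G = BEI.universalGroebnerBasis (BEI.binomialEdgeIdeal F G) ∧
      BEI.universalGroebnerBasis (BEI.binomialEdgeIdeal F G) =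
        BEI.graverBasis (BEI.binomialEdgeIdeal F G) :=
  mainTheorem1_general G
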